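/- Corollary 5.5. Let $A$ be a complete Boolean algebra. If $\operatorname{SEP}(A)$ holds, then $A$ satisfies the countable chain condition, i.e., every set of pairwise disjoint nonzero elements of $A$ is countable. Here $\operatorname{SEP}(A)$ is the following statement. For a regular cardinal $\chi$ let $\mathcal H_\chi$ be the set of all sets whose transitive closure has cardinality less than $\chi$, and let $\mathcal M_\chi$ be the set of all elementary submodels $M$ of $(\mathcal H_\chi,\in)$ with $|M|=\aleph_1$ such that $[M]^{\aleph_0}\cap M$ is cofinal in $([M]^{\aleph_0},\subseteq)$. For a subalgebra $S$ of a Boolean algebra $B$ write $S\leq_{sep}B$ if for every $b\in B$ and every uncountable $T\subseteq\{a\in S:a\leq b\}$ there is $a\in S$ with $a\leq b$ such that $\{c\in T:c\leq a\}$ is uncountable. Then $\operatorname{SEP}(A)$ says: there is a cardinal $\chi_0$ such that for every regular $\chi\geq\chi_0$ and every $X\subseteq\mathcal H_\chi$ with $|X|=\aleph_1$ there is $M\in\mathcal M_\chi$ with $X\subseteq M$ such that $A\cap M$ is a subalgebra of $A$ and $A\cap M\leq_{sep}A$. -/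

import Mathlib

open Cardinal

universe u v

namespace SepPrinciple

/-- The only symbol of the language of set theory: a binary relation symbol. -/
inductive MemRel : ℕ → Type
  | mem : MemRel 2

/-- The first-order language of set theory. -/
def setLanguage : FirstOrder.Language := ⟨fun _ => Empty, MemRel⟩

/-- Every collection of sets is a structure `(s, ∈)` for the language of set theory. -/
instance memStructure (s : Set ZFSet.{u}) : setLanguage.Structure s where
  funMap := fun f _ => Empty.elim f
  RelMap := fun r => match r with
    | .mem => fun x => (x 0 : ZFSet.{u}) ∈ (x 1 : ZFSet.{u})

/-- `H χ`: the sets whose transitive closure has cardinality less than `χ`, that is, the sets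
which are included in a transitive set of cardinality less than `χ`. -/
def H (χ : Cardinal.{u}) : Set ZFSet.{u} :=
  {x | ∃ t : ZFSet.{u}, t.IsTransitive ∧ x ⊆ t ∧ t.card < χ}

/-- `M` is (the underlying set of) an elementary submodel of `(H χ, ∈)`. -/
def IsElementarySubmodel (χ : Cardinal.{u}) (M : Set ZFSet.{u}) : Prop :=
  ∃ N : setLanguage.ElementarySubstructure (H χ), M = Subtype.val '' (N : Set (H χ))

/-- The good elementary submodels of `H χ`: those `M` of cardinality `ℵ₁` for which
`[M]^ℵ₀ ∩ M` is cofinal in `([M]^ℵ₀, ⊆)`. -/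
structure IsGood (χ : Cardinal.{u}) (M : Set ZFSet.{u}) : Prop where
  elementary : IsElementarySubmodel χ M
  card_eq : #M = ℵ₁
  cofinal : ∀ X : Set ZFSet.{u}, X ⊆ M → #X = ℵ₀ →
    ∃ y ∈ M, (y : Set ZFSet.{u}) ⊆ M ∧ y.card = ℵ₀ ∧ X ⊆ (y : Set ZFSet.{u})

/-- `S ≤_sep B` for a subalgebra `S` of the Boolean algebra `B`: for every `b` in `B`, every
uncountable subset `T` of `{a ∈ S | a ≤ b}` has uncountably many elements below a single
element of `{a ∈ S | a ≤ b}`. -/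
def SepSubalgebra {B : Type v} [BooleanAlgebra B] (S : BooleanSubalgebra B) : Prop :=
  ∀ b : B, ∀ T : Set B, T ⊆ {a | a ∈ S ∧ a ≤ b} → ¬ T.Countable →
    ∃ a ∈ S, a ≤ b ∧ ¬ {c | c ∈ T ∧ c ≤ a}.Countable

/-- `SEP(A)` for a Boolean algebra `A` whose elements are sets. The injection `i` says which set
each element of `A` is (for `X : ZFSet` and a Boolean algebra structure on the elements of `X`,
it is the inclusion), so that `i ⁻¹' M` is `A ∩ M`: for all sufficiently large regular `χ`, the
good `M` such that `A ∩ M` is a subalgebra of `A` with `A ∩ M ≤_sep A` are cofinal in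
`([H χ]^ℵ₁, ⊆)`. -/
def SEP {A : Type v} [BooleanAlgebra A] (i : A ↪ ZFSet.{u}) : Prop :=
  ∃ χ₀ : Cardinal.{u}, ∀ χ : Cardinal.{u}, χ₀ ≤ χ → χ.IsRegular →
    ∀ X : Set ZFSet.{u}, X ⊆ H χ → #X = ℵ₁ →
      ∃ M : Set ZFSet.{u}, IsGood χ M ∧ X ⊆ M ∧
        ∃ S : BooleanSubalgebra A, (S : Set A) = i ⁻¹' M ∧ SepSubalgebra S

/-- The countable chain condition: every set of pairwise disjoint nonzero elements is
countable. -/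
def CCC (A : Type v) [BooleanAlgebra A] : Prop :=
  ∀ S : Set A, (∀ a ∈ S, a ≠ ⊥) → (∀ a ∈ S, ∀ b ∈ S, a ≠ b → a ⊓ b = ⊥) → S.Countable

end SepPrinciple

/-! Put an antichain `P` of size `ℵ₁` inside some `M` given by `SEP`, so that `S = A ∩ M` has at
most `ℵ₁` elements. A diagonalization yields an uncountable `X ⊆ P` including no uncountable set `{c
∈ P | c ≤ a}` with `a ∈ S`. Separation at `b = sSup X` gives such an `a ≤ b`; by disjointness every
`c ∈ P` below `b` is already in `X`, a contradiction. -/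

/-- Recursion along a well-order of type at most `ω₁`: only countably many values are taken before
stage `j`, so `Z j` still has a fresh point. -/
theorem exists_injective_mem_of_not_countable {J : Type*} {α : Type*} (hJ : #J ≤ ℵ₁)
    (Z : J → Set α) (hZ : ∀ j, ¬ (Z j).Countable) :
    ∃ g : J → α, Function.Injective g ∧ ∀ j, g j ∈ Z j := by
  obtain ⟨e⟩ : Nonempty (J ↪ (ℵ₁ : Cardinal.{0}).ord.ToType) := by
    rw [← lift_mk_le']
    simpa using hJ
  let r : J → J → Prop := InvImage (· < ·) e
  have hr : WellFounded r := InvImage.wf e wellFounded_lt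
  have hcount (j : J) : Countable {k // r k j} := by
    have h1 : (Set.Iio (e j)).Countable := by
      rw [← le_aleph0_iff_set_countable, ← Order.lt_succ_iff, succ_aleph0]
      simpa using mk_Iio_lt (e j) (by simp)
    exact h1.preimage e.injective
  have hne (j : J) (f : ∀ k, r k j → α) :
      (Z j \ Set.range fun k : {k // r k j} => f k.1 k.2).Nonempty := by
    by_contra h
    rw [Set.not_nonempty_iff_eq_empty, Set.sdiff_eq_empty] at h
    exact hZ j ((Set.countable_range _).mono h)
  let g : J → α := hr.fix fun j f => (hne j f).some
  have hg (j : J) : g j ∈ Z j \ Set.range fun k : {k // r k j} => g k.1 := by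
    have h := (hne j fun k _ => g k).some_mem
    rwa [show g j = (hne j fun k _ => g k).some from hr.fix_eq _ j]
  have hlt {j k : J} (h : r k j) : g k ≠ g j := fun h' => (hg j).2 ⟨⟨k, h⟩, h'⟩
  refine ⟨g, fun j k h => ?_, fun j => (hg j).1⟩
  rcases lt_trichotomy (e j) (e k) with h' | h' | h'
  · exact (hlt h' h).elim
  · exact e.injective h'
  · exact (hlt h' h.symm).elim

/-- A Bernstein-type construction: an uncountable subset of `P` including none of `ℵ₁` many given
uncountable sets. -/
theorem exists_not_countable_forall_not_subset {ι : Type*} {α : Type*} (hι : #ι ≤ ℵ₁)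
    {P : Set α} (hP : ¬ P.Countable) (Y : ι → Set α) (hY : ∀ j, ¬ (Y j).Countable) :
    ∃ X ⊆ P, ¬ X.Countable ∧ ∀ j, ¬ Y j ⊆ X := by
  -- The `inr` points form `X`; the `inl j` point lies in `Y j` and, by injectivity, stays outside
  -- `X`.
  obtain ⟨g, hg, hmem⟩ := exists_injective_mem_of_not_countable
    (J := ι ⊕ (ℵ₁ : Cardinal.{0}).ord.ToType) (Z := Sum.elim Y fun _ => P)
    (by
      rw [mk_sum]
      refine add_le_of_le aleph0_lt_aleph_one.le ?_ ?_
      · simpa using hι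
      · simp)
    (by rintro (j | w) <;> simp [hY, hP])
  refine ⟨Set.range fun w => g (Sum.inr w), ?_, fun h => ?_, fun j h => ?_⟩
  · rintro _ ⟨w, rfl⟩
    exact hmem (Sum.inr w)
  · have h1 : Countable (ℵ₁ : Cardinal.{0}).ord.ToType :=
      Set.countable_univ_iff.1 <| by
        convert h.preimage (hg.comp Sum.inr_injective)
        ext w
        simp
    rw [← mk_le_aleph0_iff, mk_ord_toType] at h1
    exact h1.not_gt aleph0_lt_aleph_one
  · obtain ⟨w, hw⟩ := h (hmem (Sum.inl j))
    cases hg hw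

theorem SepPrinciple.exists_subset_H (X : Set ZFSet.{u}) [Small.{u} X] (χ₀ : Cardinal.{u}) :
    ∃ χ, χ₀ ≤ χ ∧ χ.IsRegular ∧ X ⊆ SepPrinciple.H χ := by
  let x : ZFSet.{u} := ZFSet.range (Subtype.val : X → ZFSet.{u})
  let t := ZFSet.vonNeumann x.rank
  have ht : t.IsTransitive := ZFSet.isTransitive_vonNeumann _
  refine ⟨Order.succ (χ₀ ⊔ ℵ₀ ⊔ t.card), ?_, isRegular_succ ?_, fun y hy => ⟨t, ht, ?_, ?_⟩⟩
  · exact (le_sup_left.trans le_sup_left).trans (Order.le_succ _)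
  · exact le_sup_right.trans le_sup_left
  · exact ht.subset_of_mem (ZFSet.subset_vonNeumann_self x (ZFSet.mem_range.2 ⟨⟨y, hy⟩, rfl⟩))
  · exact Order.lt_succ_of_le le_sup_right

theorem SepPrinciple.SepSubalgebra.countable_antichain {A : Type v} [CompleteBooleanAlgebra A]
    {S : BooleanSubalgebra A} (hS : SepPrinciple.SepSubalgebra S) (hcard : #S ≤ ℵ₁) {P : Set A}
    (hPS : P ⊆ S) (hne : ∀ a ∈ P, a ≠ ⊥) (hdisj : ∀ a ∈ P, ∀ b ∈ P, a ≠ b → a ⊓ b = ⊥) :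
    P.Countable := by
  by_contra hP
  obtain ⟨X, hXP, hX, hY⟩ := exists_not_countable_forall_not_subset
    (ι := {a : S // ¬ {c ∈ P | c ≤ a.1}.Countable}) ((mk_subtype_le _).trans hcard) hP
    (fun a => {c ∈ P | c ≤ a.1.1}) (fun a => a.2)
  obtain ⟨a, haS, hab, ha⟩ := hS (sSup X) X (fun c hc => ⟨hPS (hXP hc), le_sSup hc⟩) hX
  have hsub : {c | c ∈ X ∧ c ≤ a} ⊆ {c ∈ P | c ≤ a} := fun c hc => ⟨hXP hc.1, hc.2⟩
  refine hY ⟨⟨a, haS⟩, fun h => ha (h.mono hsub)⟩ ?_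
  rintro c ⟨hcP, hca : c ≤ a⟩
  by_contra hcX
  refine hne c hcP ?_
  -- If `c ∉ X`, then `c` is disjoint from each member of `X`, hence from `sSup X` by
  -- distributivity, although `c ≤ sSup X`.
  have hc : c ⊓ sSup X = c := inf_eq_left.2 (hca.trans hab)
  rw [← hc, inf_sSup_eq, iSup₂_eq_bot]
  exact fun b hb => hdisj c hcP b (hXP hb) fun h => hcX (h ▸ hb)

theorem corollary5p5 (A : Type v) [CompleteBooleanAlgebra A] [Small.{u} A]
    (i : A ↪ ZFSet.{u}) (hA : SepPrinciple.SEP i) : SepPrinciple.CCC A := by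
  intro Q hne hdisj
  by_contra hQ
  obtain ⟨P, hPQ, hP⟩ : ∃ P ⊆ Q, #P = ℵ₁ := by
    rw [← le_mk_iff_exists_subset, ← succ_aleph0, Order.succ_le_iff, ← not_le]
    rwa [le_aleph0_iff_set_countable]
  obtain ⟨χ₀, hχ₀⟩ := hA
  obtain ⟨χ, hχ, hreg, hH⟩ := SepPrinciple.exists_subset_H (i '' P) χ₀
  have hcard : #(i '' P) = ℵ₁ := by
    have h := mk_image_eq_lift i P i.injective
    rw [hP] at h
    rwa [lift_aleph, Ordinal.lift_one, lift_eq_aleph_one] at h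
  obtain ⟨M, hM, hPM, S, hSM, hS⟩ := hχ₀ χ hχ hreg _ hH hcard
  have hScard : #S ≤ ℵ₁ := by
    have h := mk_preimage_of_injective_lift i M i.injective
    rw [hM.card_eq, ← hSM] at h
    simpa using h
  have hcount : P.Countable := hS.countable_antichain hScard
    (fun a ha => hSM ▸ hPM ⟨a, ha, rfl⟩) (fun a ha => hne a (hPQ ha))
    (fun a ha b hb => hdisj a (hPQ ha) b (hPQ hb))
  rw [← le_aleph0_iff_set_countable, hP] at hcount
  exact hcount.not_gt aleph0_lt_aleph_one
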